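/- A spectral space is a compact, $T_0$, sober topological space whose compact open subsets are closed under finite intersections and form a basis; a spectral map is a continuous map such that preimages of compact open sets are compact open. Write $\mathcal{K}^o(X)$ for the set of compact open subsets of $X$ and $\mathbf{n}=\{1,\dots,n\}$. A \emph{type space functor} is a functor $F:\mathbf{FinSet}^{\mathrm{op}}\to\mathbf{Spec}$ from finite sets to spectral spaces and spectral maps such that every map in its image is open and, for every pushout square in $\mathbf{FinSet}$ with maps $h:\mathbf d\to\mathbf b$, $k:\mathbf d\to\mathbf c$, $f:\mathbf b\to\mathbf a$, $g:\mathbf c\to\mathbf a$ ($fh=gk$), the Beck--Chevalley condition $F_g(F_f^{-1}(U))=F_k^{-1}(F_h(U))$ holds for all $U\in\mathcal{K}^o(F_b)$. Here $F_n=F(\mathbf n)$ and $F_f:F_m\to F_n$ is the map induced by $f:\mathbf n\to\mathbf m$. Let $\mathcal{L}(F)$ be the relational signature with an $n$-ary relation symbol $R_U$ for every $n\ge 0$ and every $U\in\mathcal{K}^o(F_n)$. Coherent formulas are built from atomic formulas using $\top,\bot,\wedge,\vee,\exists$. Each coherent $\mathcal{L}(F)$-formula $\phi$ in the variables $x_1,\dots,x_n$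 is interpreted as a compact open set $\llbracket\phi\rrbracket\subseteq F_n$ by recursion: \begin{itemize} \item $\llbracket\top\rrbracket=F_n$ and $\llbracket\bot\rrbracket=\emptyset$; \item $\llbracket R_U(x_{f(1)},\dots,x_{f(k)})\rrbracket=F_f^{-1}(U)$ for $f:\mathbf k\to\mathbf n$ and $U\in\mathcal{K}^o(F_k)$; \item $\llbracket x_i=x_j\rrbracket=F_e(F_n)$, where $e:\mathbf n\to\mathbf n$ sends $i$ to $j$ and fixes every other element; \item $\llbracket\phi\wedge\psi\rrbracket=\llbracket\phi\rrbracket\cap\llbracket\psi\rrbracket$ and $\llbracket\phi\vee\psi\rrbracket=\llbracket\phi\rrbracket\cup\llbracket\psi\rrbracket$; \item $\llbracket\exists x_{n+1}\phi\rrbracket=F_\iota(\llbracket\phi\rrbracket)$, where $\phi$ is in the variables $x_1,\dots,x_{n+1}$ and $\iota:\mathbf n\to\mathbf{n+1}$ is the inclusion. \end{itemize} Let $\mathrm{Th}(F)$ be the set of all sentences $\forall x_1\cdots x_n(\phi\to\psi)$, where $n\ge 0$ and $\phi,\psi$ are coherent $\mathcal{L}(F)$-formulas in the variables $x_1,\dots,x_n$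 with $\llbracket\phi\rrbracket\subseteq\llbracket\psi\rrbracket$ in $F_n$. Write $T\models\sigma$ if the sentence $\sigma$ is true, in the usual set-theoretic semantics, in every model of $T$, where models are allowed to be empty. \textbf{Theorem.} Let $F$ be a type space functor, $n\ge 0$, and let $\phi,\psi$ be coherent $\mathcal{L}(F)$-formulas in the variables $\bar x=(x_1,\dots,x_n)$. Then \[ \mathrm{Th}(F)\models\forall\bar x(\phi(\bar x)\to\psi(\bar x))\quad\text{if and only if}\quad\llbracket\phi\rrbracket\subseteq\llbracket\psi\rrbracket . \] -/

import Mathlib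

open CategoryTheory TopologicalSpace

universe u

/-! ### The category of spectral spaces and spectral maps -/

/-- A bundled spectral space. -/
structure SpectralCat : Type (u + 1) where
  carrier : Type u
  [top : TopologicalSpace carrier]
  [spectral : SpectralSpace carrier]

namespace SpectralCat

instance : CoeSort SpectralCat.{u} (Type u) := ⟨SpectralCat.carrier⟩

instance (X : SpectralCat.{u}) : TopologicalSpace X := X.top

instance (X : SpectralCat.{u}) : SpectralSpace X := X.spectral

instance : Category SpectralCat.{u} where
  Hom X Y := SpectralMap X Y
  id X := SpectralMap.id X
  comp f g := SpectralMap.comp g f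

instance : ConcreteCategory SpectralCat.{u} (fun X Y => SpectralMap X Y) where
  hom f := f
  ofHom f := f

end SpectralCat

/-! ### Type space functors -/

/-- The Beck–Chevalley condition for a square `f : A → B`, `g : A → C`, `h : B → D`, `k : C → D`:
`g (f⁻¹ U) = k⁻¹ (h U)` for all compact open `U ⊆ B`. -/
def BeckChevalley {A B C D : Type u} [TopologicalSpace B]
    (f : A → B) (g : A → C) (h : B → D) (k : C → D) : Prop :=
  ∀ U : CompactOpens B, g '' (f ⁻¹' (U : Set B)) = k ⁻¹' (h '' (U : Set B))

/-- A type space functor: a functor `FinSetᵒᵖ ⥤ Spec` all of whose maps are open, and which sends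
every pushout square to a square satisfying the Beck–Chevalley condition. -/
structure TypeSpaceFunctor where
  toFunctor : FintypeCat.{0}ᵒᵖ ⥤ SpectralCat.{u}
  isOpenMap : ∀ {X Y : FintypeCat.{0}ᵒᵖ} (f : X ⟶ Y), IsOpenMap (toFunctor.map f)
  beckChevalley : ∀ {a b c d : FintypeCat.{0}} {h : d ⟶ b} {k : d ⟶ c} {f : b ⟶ a} {g : c ⟶ a},
    IsPushout h k f g →
    BeckChevalley (toFunctor.map f.op) (toFunctor.map g.op)
      (toFunctor.map h.op) (toFunctor.map k.op)

namespace TypeSpaceFunctor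

variable (F : TypeSpaceFunctor.{u})

/-- The spectral space `F_n`. -/
abbrev space (n : ℕ) : SpectralCat.{u} :=
  F.toFunctor.obj (Opposite.op (FintypeCat.of (Fin n)))

/-- The spectral map `F_f : F_m → F_n` induced by `f : {1, …, n} → {1, …, m}`. -/
def map {n m : ℕ} (f : Fin n → Fin m) : SpectralMap (F.space m) (F.space n) :=
  F.toFunctor.map (FintypeCat.homMk (X := FintypeCat.of (Fin n)) (Y := FintypeCat.of (Fin m)) f).op

theorem isOpenMap_map {n m : ℕ} (f : Fin n → Fin m) : IsOpenMap (F.map f) :=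
  F.isOpenMap _

/-- The direct image of a compact open set under `F_f`. -/
def image {n m : ℕ} (f : Fin n → Fin m) (U : CompactOpens (F.space m)) :
    CompactOpens (F.space n) :=
  U.map (F.map f) (F.map f).spectral'.continuous (F.isOpenMap_map f)

/-- The preimage of a compact open set under `F_f`. -/
def preimage {n m : ℕ} (f : Fin n → Fin m) (U : CompactOpens (F.space n)) :
    CompactOpens (F.space m) where
  carrier := F.map f ⁻¹' U
  isCompact' := (F.map f).spectral'.isCompact_preimage_of_isOpen U.isOpen U.isCompact
  isOpen' := U.isOpen.preimage (F.map f).spectral'.continuous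

end TypeSpaceFunctor

/-! ### Coherent logic over a relational signature -/

/-- Coherent formulas with free variables among `x_0, …, x_{n-1}` over a relational signature (so
the only terms are variables). In `ex φ`, the bound variable is the last variable `x_n` of `φ`. -/
inductive CohFormula (L : FirstOrder.Language.{0, u}) [L.IsRelational] : ℕ → Type u
  | top {n : ℕ} : CohFormula L n
  | bot {n : ℕ} : CohFormula L n
  | rel {k n : ℕ} (R : L.Relations k) (f : Fin k → Fin n) : CohFormula L n
  | eq {n : ℕ} (i j : Fin n) : CohFormula L n
  | and {n : ℕ} (φ ψ : CohFormula L n) : CohFormula L n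
  | or {n : ℕ} (φ ψ : CohFormula L n) : CohFormula L n
  | ex {n : ℕ} (φ : CohFormula L (n + 1)) : CohFormula L n

section CoherentLogic

variable {L : FirstOrder.Language.{0, u}} [L.IsRelational]

/-- Classical (Tarski) satisfaction of a coherent formula in a possibly empty structure. -/
def CohFormula.Realize (M : Type u) [L.Structure M] :
    {n : ℕ} → CohFormula L n → (Fin n → M) → Prop
  | _, .top, _ => True
  | _, .bot, _ => False
  | _, .rel R f, v => FirstOrder.Language.Structure.RelMap R (v ∘ f)
  | _, .eq i j, v => v i = v j
  | _, .and φ ψ, v => φ.Realize M v ∧ ψ.Realize M v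
  | _, .or φ ψ, v => φ.Realize M v ∨ ψ.Realize M v
  | _, .ex φ, v => ∃ a : M, φ.Realize M (Fin.snoc v a)

/-- A sequent `φ ⊢_{x̄} ψ` in `n` variables, i.e. the h-inductive sentence `∀ x̄ (φ → ψ)`. -/
structure CohSequent (L : FirstOrder.Language.{0, u}) [L.IsRelational] where
  n : ℕ
  lhs : CohFormula L n
  rhs : CohFormula L n

/-- The sentence `∀ x̄ (φ → ψ)` is true in `M`. -/
def CohSequent.TrueIn (s : CohSequent L) (M : Type u) [L.Structure M] : Prop :=
  ∀ v : Fin s.n → M, s.lhs.Realize M v → s.rhs.Realize M v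

/-- A coherent theory is a set of h-inductive sentences. -/
abbrev CohTheory (L : FirstOrder.Language.{0, u}) [L.IsRelational] := Set (CohSequent L)

/-- `M` is a model of `T`. -/
def CohTheory.IsModel (T : CohTheory L) (M : Type u) [L.Structure M] : Prop :=
  ∀ s ∈ T, s.TrueIn M

/-- `T ⊨ s`: the sentence `s` is true in every model of `T`, including empty models. -/
def CohTheory.Entails (T : CohTheory L) (s : CohSequent L) : Prop :=
  ∀ (M : Type u) [L.Structure M], T.IsModel M → s.TrueIn M

end CoherentLogic

/-! ### The internal logic and the theory of a type space functor -/

namespace TypeSpaceFunctor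

variable (F : TypeSpaceFunctor.{u})

/-- The relational signature `L(F)`: an `n`-ary relation symbol for each compact open subset of
`F_n`. -/
def lang : FirstOrder.Language.{0, u} where
  Functions _ := Empty
  Relations n := CompactOpens (F.space n)

instance : F.lang.IsRelational := fun _ => inferInstanceAs (IsEmpty Empty)

/-- The interpretation `⟦φ⟧ ⊆ F_n` of an `n`-ary `L(F)`-formula `φ` as a compact open set. -/
def interp : {n : ℕ} → CohFormula F.lang n → CompactOpens (F.space n)
  | _, .top => ⊤
  | _, .bot => ⊥
  | _, .rel (k := k) R f => F.preimage f (show CompactOpens (F.space k) from R)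
  | _, .eq i j => F.image (Function.update id i j) ⊤
  | _, .and φ ψ => interp φ ⊓ interp ψ
  | _, .or φ ψ => interp φ ⊔ interp ψ
  | _, .ex φ => F.image Fin.castSucc (interp φ)

/-- The theory `Th(F) = {φ ⊢_{x̄} ψ : ⟦φ⟧ ⊆ ⟦ψ⟧}`. -/
def theory : CohTheory F.lang :=
  {s | (F.interp s.lhs : Set (F.space s.n)) ⊆ F.interp s.rhs}

end TypeSpaceFunctor

/-! Soundness is immediate, since the sequent itself lies in `Th(F)`. Conversely, every point of
`F_n` is the type of a tuple in some model, so a point of `⟦φ⟧` outside `⟦ψ⟧` refutes the sequent.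
Models come from point families, which assign compatible types to all finite tuples; with witnesses
and separation, truth is membership (`realize_iff`). A Henkin construction supplies witnesses:
Beck–Chevalley adjoins them one at a time, and compactness of the constructible topology passes to
the limit. Beck–Chevalley for the diagonal makes the quotient by indiscernibility separated
(`indiscernible_of_pt_eq`). -/

/-! ### Compact opens in spectral spaces -/

/-- Every ultrafilter on a spectral space has a limit in the constructible topology. -/
theorem Ultrafilter.exists_forall_mem_compactOpens_iff {X : Type*} [TopologicalSpace X]
    [SpectralSpace X] (𝒰 : Ultrafilter X) :
    ∃ x : X, ∀ U : CompactOpens X, x ∈ U ↔ (U : Set X) ∈ 𝒰 := by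
  let e : X → WithConstructibleTopology X := WithTopology.toTopology _
  obtain ⟨y, -, hy⟩ := isCompact_univ.ultrafilter_le_nhds (𝒰.map e) (by simp)
  have key : ∀ s : Set X, @IsOpen X (constructibleTopology X) s → y.ofTopology ∈ s → s ∈ 𝒰 := by
    intro s hs hys
    exact hy (IsOpen.mem_nhds
      (s := (fun z : WithConstructibleTopology X => z.ofTopology) ⁻¹' s)
      (WithConstructibleTopology.isOpen_iff.2 hs) hys)
  -- Compact opens and their complements are both constructibly open, so the limit decides
  -- membership in both directions.
  refine ⟨y.ofTopology, fun U => ⟨fun h => ?_, fun h => ?_⟩⟩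
  · exact key _ (U.isCompact.isOpen_constructibleTopology_of_isOpen U.isOpen) h
  · by_contra hU
    exact Ultrafilter.compl_mem_iff_notMem.1 (key (U : Set X)ᶜ
      (IsCompact.isOpen_constructibleTopology_of_isClosed (by simpa using U.isCompact)
        U.isOpen.isClosed_compl) hU) h

/-- Points of a spectral space are separated by compact open sets. -/
theorem SpectralSpace.eq_of_forall_mem_compactOpens_iff {X : Type*} [TopologicalSpace X]
    [SpectralSpace X] {x y : X} (h : ∀ U : CompactOpens X, x ∈ U ↔ y ∈ U) : x = y := by
  refine (PrespectralSpace.isTopologicalBasis (X := X)).inseparable_iff.2 ?_ |>.eq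
  rintro s ⟨hs, hs'⟩
  exact h ⟨⟨s, hs'⟩, hs⟩

/-! ### Amalgamation -/

namespace TypeSpaceFunctor

variable (F : TypeSpaceFunctor.{u})

theorem map_comp {k m n : ℕ} (f : Fin k → Fin m) (g : Fin m → Fin n) (x : F.space n) :
    F.map (g ∘ f) x = F.map f (F.map g x) :=
  ConcreteCategory.congr_hom (F.toFunctor.map_comp
    (FintypeCat.homMk (X := FintypeCat.of (Fin m)) (Y := FintypeCat.of (Fin n)) g).op
    (FintypeCat.homMk (X := FintypeCat.of (Fin k)) (Y := FintypeCat.of (Fin m)) f).op) x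

theorem map_id {n : ℕ} (x : F.space n) : F.map id x = x :=
  ConcreteCategory.congr_hom (F.toFunctor.map_id (Opposite.op (FintypeCat.of (Fin n)))) x

/-- Amalgamation over a pushout square, from the Beck–Chevalley condition. -/
theorem exists_map_mem_and_map_eq {a b c d : ℕ} {h : Fin d → Fin b} {k : Fin d → Fin c}
    {f : Fin b → Fin a} {g : Fin c → Fin a} (w : f ∘ h = g ∘ k)
    (desc : ∀ (Z : Type) (s : Fin b → Z) (t : Fin c → Z), s ∘ h = t ∘ k →
      ∃! r : Fin a → Z, r ∘ f = s ∧ r ∘ g = t)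
    {x : F.space c} {y : F.space b} {U : CompactOpens (F.space b)} (hy : y ∈ U)
    (hxy : F.map h y = F.map k x) : ∃ z, F.map f z ∈ U ∧ F.map g z = x := by
  have hp : IsPushout
      (FintypeCat.homMk (X := FintypeCat.of (Fin d)) (Y := FintypeCat.of (Fin b)) h)
      (FintypeCat.homMk (X := FintypeCat.of (Fin d)) (Y := FintypeCat.of (Fin c)) k)
      (FintypeCat.homMk (X := FintypeCat.of (Fin b)) (Y := FintypeCat.of (Fin a)) f)
      (FintypeCat.homMk (X := FintypeCat.of (Fin c)) (Y := FintypeCat.of (Fin a)) g) := by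
    have H : ∀ s : Limits.PushoutCocone
        (FintypeCat.homMk (X := FintypeCat.of (Fin d)) (Y := FintypeCat.of (Fin b)) h)
        (FintypeCat.homMk (X := FintypeCat.of (Fin d)) (Y := FintypeCat.of (Fin c)) k),
        ∃! r : Fin a → s.pt.obj, r ∘ f = (s.inl : _ → _) ∧ r ∘ g = (s.inr : _ → _) :=
      fun s => desc _ _ _ (funext fun i => ConcreteCategory.congr_hom s.condition i)
    refine ⟨⟨FintypeCat.hom_ext _ _ (congrFun w)⟩, ⟨Limits.PushoutCocone.IsColimit.mk _
      (fun s => FintypeCat.homMk (H s).choose) (fun s => ?_) (fun s => ?_) (fun s m h₁ h₂ => ?_)⟩⟩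
    · exact FintypeCat.hom_ext _ _ (congrFun (H s).choose_spec.1.1)
    · exact FintypeCat.hom_ext _ _ (congrFun (H s).choose_spec.1.2)
    · exact FintypeCat.hom_ext _ _ (congrFun ((H s).choose_spec.2 (m : _ → _)
        ⟨funext fun i => ConcreteCategory.congr_hom h₁ i,
          funext fun i => ConcreteCategory.congr_hom h₂ i⟩))
  have hx : x ∈ F.map k ⁻¹' (F.map h '' (U : Set (F.space b))) := ⟨y, hy, hxy⟩
  have hBC : F.map g '' (F.map f ⁻¹' U) = F.map k ⁻¹' (F.map h '' (U : Set (F.space b))) :=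
    F.beckChevalley hp U
  rw [← hBC] at hx
  exact hx

/-- A witness for an existential formula over a tuple `b` can be adjoined to any point. -/
theorem exists_map_snoc_mem {k m : ℕ} (b : Fin k → Fin m) (x : F.space m)
    (U : CompactOpens (F.space (k + 1))) (hx : F.map b x ∈ F.image Fin.castSucc U) :
    ∃ z : F.space (m + 1), F.map (Fin.snoc (Fin.castSucc ∘ b) (Fin.last m)) z ∈ U ∧
      F.map Fin.castSucc z = x := by
  obtain ⟨y, hy, hxy⟩ := hx
  -- Adjoining a variable to `m` is the pushout along `b` of adjoining one to `k`.
  refine F.exists_map_mem_and_map_eq (h := Fin.castSucc) (k := b)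
    (by rw [Fin.snoc_comp_castSucc]) (fun Z s t hst => ?_) hy hxy
  refine ⟨Fin.snoc t (s (Fin.last k)), ⟨?_, Fin.snoc_comp_castSucc⟩, ?_⟩
  · funext i
    cases i using Fin.lastCases with
    | last => simp
    | cast i => simpa using (congrFun hst i).symm
  · rintro r ⟨rfl, rfl⟩
    funext i
    cases i using Fin.lastCases <;> simp

/-- A point whose last two coordinates are equal comes from a point with these identified. -/
theorem exists_map_snoc_last_eq {m : ℕ} (x : F.space (m + 2)) (y : F.space 1)
    (hxy : F.map ![0, 0] y = F.map ![(Fin.last m).castSucc, Fin.last (m + 1)] x) :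
    ∃ z : F.space (m + 1), F.map (Fin.snoc id (Fin.last m)) z = x := by
  -- Identifying two variables is the pushout of the fold of a two-element set along the map
  -- selecting them.
  have w : ![Fin.last m] ∘ ![0, 0] = (Fin.snoc id (Fin.last m) : Fin (m + 2) → Fin (m + 1)) ∘
      ![(Fin.last m).castSucc, Fin.last (m + 1)] := by
    funext i
    fin_cases i
    · exact (Fin.snoc_castSucc (α := fun _ => Fin (m + 1)) (Fin.last m) id (Fin.last m)).symm
    · exact (Fin.snoc_last (α := fun _ => Fin (m + 1)) _ _).symm
  have desc : ∀ (Z : Type) (s : Fin 1 → Z) (t : Fin (m + 2) → Z),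
      s ∘ ![0, 0] = t ∘ ![(Fin.last m).castSucc, Fin.last (m + 1)] →
        ∃! r : Fin (m + 1) → Z, r ∘ ![Fin.last m] = s ∧ r ∘ Fin.snoc id (Fin.last m) = t := by
    intro Z s t hst
    have h₀ : s 0 = t (Fin.last m).castSucc := congrFun hst 0
    have h₁ : s 0 = t (Fin.last (m + 1)) := congrFun hst 1
    refine ⟨t ∘ Fin.castSucc, ⟨?_, ?_⟩, ?_⟩
    · funext i
      fin_cases i
      exact h₀.symm
    · funext i
      cases i using Fin.lastCases with
      | last => simp [← h₁, h₀]
      | cast i => simp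
    · rintro r ⟨rfl, rfl⟩
      funext i
      simp
  obtain ⟨z, -, hz⟩ := F.exists_map_mem_and_map_eq w desc (U := ⊤) (Set.mem_univ y) hxy
  exact ⟨z, hz⟩

/-! ### Point families as structures -/

/-- A point of `F` at the possibly infinite set of variables `I`: a compatible assignment of a
point of `F_k` to each `k`-tuple of elements of `I`. -/
structure PointFamily (I : Type u) where
  pt : ∀ {k : ℕ}, (Fin k → I) → F.space k
  map_pt : ∀ {k m : ℕ} (f : Fin k → Fin m) (a : Fin m → I), F.map f (pt a) = pt (a ∘ f)

namespace PointFamily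

variable {F} {I : Type u} (P : F.PointFamily I)

/-- Every existential formula holding at a tuple is witnessed by an element of `I`. -/
def HasWitnesses : Prop :=
  ∀ {k : ℕ} (a : Fin k → I) (U : CompactOpens (F.space (k + 1))),
    P.pt a ∈ F.image Fin.castSucc U → ∃ c : I, P.pt (Fin.snoc a c) ∈ U

/-- Elements of `I` that `F` regards as equal are equal. -/
def IsSeparated : Prop :=
  ∀ c d : I, P.pt ![c, d] = P.pt ![d, d] → c = d

/-- The `L(F)`-structure on `I` defined by a point family. -/
@[reducible] def toStructure : F.lang.Structure I where
  funMap f := f.elim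
  RelMap {k} R a := P.pt a ∈ (show CompactOpens (F.space k) from R)

/-- If `pt v` is `F_e y`, the pairs at `(i, j)` and `(j, j)` get the same point because `e` sends
both `i` and `j` to `j`; separation then applies. Conversely, `v ∘ e = v` when `v i = v j`, so `pt
v` is its own preimage. -/
theorem pt_mem_interp_eq_iff (hs : P.IsSeparated) {n : ℕ} (i j : Fin n) (v : Fin n → I) :
    P.pt v ∈ F.interp (.eq i j : CohFormula F.lang n) ↔ v i = v j := by
  constructor
  · rintro ⟨y, -, hy⟩
    have h : ∀ k : Fin n, P.pt ![v k, v j] = F.map (Function.update id i j ∘ ![k, j]) y := by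
      intro k
      rw [F.map_comp, show F.map (Function.update id i j) y = P.pt v from hy, P.map_pt]
      congr 1
      funext l
      fin_cases l <;> rfl
    apply hs
    rw [h, h]
    congr 2
    funext l
    fin_cases l
    · by_cases hij : j = i <;> simp [hij]
    · rfl
  · intro h
    refine ⟨P.pt v, trivial, (P.map_pt _ _).trans ?_⟩
    congr 1
    funext k
    by_cases hk : k = i
    · subst hk; simp [h]
    · simp [hk]

/-- Satisfaction in the structure of a separated point family with witnesses is membership in the
interpretation. -/
theorem realize_iff (hw : P.HasWitnesses) (hs : P.IsSeparated) {n : ℕ} (φ : CohFormula F.lang n)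
    (v : Fin n → I) :
    letI := P.toStructure
    φ.Realize I v ↔ P.pt v ∈ F.interp φ := by
  induction φ with
  | top => exact iff_of_true trivial trivial
  | bot => exact iff_of_false id id
  | rel R f =>
    exact iff_of_eq (congrArg (· ∈ (show CompactOpens (F.space _) from R)) (P.map_pt f v).symm)
  | eq i j => exact (P.pt_mem_interp_eq_iff hs i j v).symm
  | and φ ψ hφ hψ => exact and_congr (hφ v) (hψ v)
  | or φ ψ hφ hψ => exact or_congr (hφ v) (hψ v)
  | ex φ hφ =>
    constructor
    · rintro ⟨c, hc⟩
      exact ⟨_, (hφ _).1 hc, (P.map_pt _ _).trans (by rw [Fin.snoc_comp_castSucc])⟩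
    · intro h
      obtain ⟨c, hc⟩ := hw v (F.interp φ) h
      exact ⟨c, (hφ _).2 hc⟩

/-- A separated point family with witnesses is a model of `Th(F)`. -/
theorem isModel (hw : P.HasWitnesses) (hs : P.IsSeparated) :
    letI := P.toStructure
    F.theory.IsModel I :=
  fun _ h v hv => (P.realize_iff hw hs _ v).2 (h ((P.realize_iff hw hs _ v).1 hv))

/-! ### Quotient by indiscernibility -/

/-- Two elements are indiscernible if replacing one by the other in a tuple never changes the point
of that tuple. -/
def indiscernible : Setoid I where
  r c d := ∀ {n : ℕ} (a : Fin n → I) (i : Fin n),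
    P.pt (Function.update a i c) = P.pt (Function.update a i d)
  iseqv := ⟨fun _ _ _ _ => rfl, fun h _ a i => (h a i).symm,
    fun h h' _ a i => (h a i).trans (h' a i)⟩

/-- Coordinates are exchanged one at a time. -/
theorem pt_congr {n : ℕ} (a b : Fin n → I) (h : ∀ i, P.indiscernible (a i) (b i)) :
    P.pt a = P.pt b := by
  suffices H : ∀ s : Finset (Fin n), P.pt (s.piecewise b a) = P.pt a by
    simpa using (H Finset.univ).symm
  intro s
  induction s using Finset.induction_on with
  | empty => simp
  | insert j s hj ih =>
    rw [Finset.piecewise_insert, ← h j (s.piecewise b a) j, ← ih]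
    congr 1
    rw [Function.update_eq_self_iff]
    simp [hj]

/-- The type of `(a, c, d)` restricts to the diagonal on its last two variables, so it comes from a
point `z` with one variable serving for both `c` and `d`. Both substituted tuples are then the same
reindexing of `z`. -/
theorem indiscernible_of_pt_eq {c d : I} (h : P.pt ![c, d] = P.pt ![d, d]) :
    P.indiscernible c d := by
  intro n a i
  let v : Fin (n + 2) → I := Fin.snoc (Fin.snoc a c : Fin (n + 1) → I) d
  have hv₀ : v (Fin.last n).castSucc = c := by
    simp only [v, Fin.snoc_castSucc, Fin.snoc_last]
  have hv₁ : v (Fin.last (n + 1)) = d := by simp only [v, Fin.snoc_last]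
  have hv₂ : ∀ k : Fin n, v k.castSucc.castSucc = a k := fun k => by
    simp only [v, Fin.snoc_castSucc]
  obtain ⟨z, hz⟩ := F.exists_map_snoc_last_eq (P.pt v) (P.pt ![d]) (by
    rw [P.map_pt, P.map_pt]
    refine Eq.trans ?_ (h.symm.trans ?_)
    · congr 1
      funext l
      fin_cases l <;> rfl
    · congr 1
      funext l
      fin_cases l
      · exact hv₀.symm
      · exact hv₁.symm)
  have key : ∀ e : Fin (n + 2), Function.update a i (v e) =
      v ∘ Function.update (fun k : Fin n => k.castSucc.castSucc) i e := by
    intro e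
    funext k
    by_cases hk : k = i
    · subst hk; simp
    · simp [hk, hv₂]
  rw [← hv₀, ← hv₁, key, key, ← P.map_pt, ← P.map_pt, ← hz, ← F.map_comp, ← F.map_comp]
  congr 2
  funext k
  by_cases hk : k = i
  · subst hk
    simp only [Function.comp_apply, Function.update_self, Fin.snoc_last, Fin.snoc_castSucc, id]
  · simp [hk]

/-- The restriction of a point family along a map of index sets. -/
def comap {J : Type u} (s : J → I) : F.PointFamily J where
  pt a := P.pt (s ∘ a)
  map_pt _ _ := P.map_pt _ _

/-- A point family with witnesses has a separated quotient with witnesses and the same points. -/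
theorem exists_isSeparated (hw : P.HasWitnesses) {n : ℕ} (a : Fin n → I) :
    ∃ (M : Type u) (Q : F.PointFamily M), Q.HasWitnesses ∧ Q.IsSeparated ∧
      ∃ b : Fin n → M, Q.pt b = P.pt a := by
  have hout : ∀ c : I, P.indiscernible (Quotient.out (Quotient.mk P.indiscernible c)) c :=
    @Quotient.mk_out _ P.indiscernible
  refine ⟨Quotient P.indiscernible, P.comap Quotient.out, ?_, ?_, Quotient.mk _ ∘ a, ?_⟩
  · intro k b U hb
    obtain ⟨c, hc⟩ := hw _ U hb
    refine ⟨Quotient.mk _ c, ?_⟩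
    change P.pt (Quotient.out ∘ Fin.snoc b (Quotient.mk _ c)) ∈ U
    rw [Fin.comp_snoc]
    -- The chosen representative of the class of `c` may differ from `c`, but only up to
    -- indiscernibility.
    have := hout c (Fin.snoc (Quotient.out ∘ b) c) (Fin.last k)
    rw [Fin.update_snoc_last, Fin.update_snoc_last] at this
    rwa [this]
  · intro c d h
    refine Quotient.out_equiv_out.1 (P.indiscernible_of_pt_eq ?_)
    refine Eq.trans ?_ (Eq.trans h ?_)
    all_goals
      refine congrArg P.pt (funext fun l => ?_)
      fin_cases l <;> rfl
  · exact P.pt_congr _ _ fun i => hout (a i)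

end PointFamily

/-! ### Henkin construction -/

/-- Henkin terms over `n` variables. -/
inductive HenkinTerm (n : ℕ) : Type u
  | var (i : Fin n)
  | wit {k : ℕ} (a : Fin k → HenkinTerm n) (U : CompactOpens (F.space (k + 1)))

namespace HenkinTerm

variable {F} {n : ℕ}

/-- The nesting depth of a Henkin term. -/
def depth : F.HenkinTerm n → ℕ
  | var _ => 0
  | wit a _ => (Finset.univ.sup fun i => (a i).depth) + 1

theorem depth_lt {k : ℕ} (a : Fin k → F.HenkinTerm n) (U : CompactOpens (F.space (k + 1)))
    (i : Fin k) : (a i).depth < (wit a U).depth := by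
  rw [depth]
  exact Nat.lt_succ_of_le (Finset.le_sup (f := fun i => (a i).depth) (Finset.mem_univ i))

/-- An assignment of coordinates of a point of some `F_m` to all Henkin terms. -/
structure Assignment (F : TypeSpaceFunctor.{u}) (n : ℕ) where
  m : ℕ
  point : F.space m
  coord : F.HenkinTerm n → Fin m

/-- The point of the tuple `a` under an assignment. -/
def Assignment.eval (A : Assignment F n) {k : ℕ} (a : Fin k → F.HenkinTerm n) : F.space k :=
  F.map (A.coord ∘ a) A.point

theorem Assignment.map_eval (A : Assignment F n) {k l : ℕ} (f : Fin k → Fin l)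
    (a : Fin l → F.HenkinTerm n) : F.map f (A.eval a) = A.eval (a ∘ f) :=
  (F.map_comp f (A.coord ∘ a) A.point).symm

/-- The Henkin condition on the term `t`, under the assignment `A`. -/
def Assignment.Good (A : Assignment F n) (t : F.HenkinTerm n) : Prop :=
  ∀ (k : ℕ) (a : Fin k → F.HenkinTerm n) (U : CompactOpens (F.space (k + 1))), t = wit a U →
    A.eval a ∈ F.image Fin.castSucc U → A.eval (Fin.snoc a t) ∈ U

open Classical in
/-- Finitely many Henkin conditions can be satisfied over any point of `F_n` with `n > 0`. -/
theorem exists_assignment [NeZero n] (p : F.space n) (s : Finset (F.HenkinTerm n)) :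
    ∃ A : Assignment F n, A.eval var = p ∧ ∀ t ∈ s, A.Good t := by
  -- Terms are treated by increasing depth: a new term of maximal depth is not an argument of any
  -- earlier one, so moving it to a fresh coordinate preserves the earlier conditions.
  refine Finset.induction_on_max_value depth s ?_ fun t s ht hmax ih => ?_
  -- The coordinate `0` given to witness terms is arbitrary; its existence requires `n > 0`.
  · refine ⟨⟨n, p, fun t => match t with | var i => i | wit _ _ => 0⟩, ?_, by simp⟩
    exact F.map_id p
  · obtain ⟨A, hA, hs⟩ := ih
    by_cases hgood : A.Good t
    · exact ⟨A, hA, by simpa [hgood] using hs⟩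
    unfold Assignment.Good at hgood
    push Not at hgood
    obtain ⟨k, a, U, rfl, hU, -⟩ := hgood
    obtain ⟨z, hz, hzA⟩ := F.exists_map_snoc_mem _ _ U hU
    let B : Assignment F n :=
      ⟨A.m + 1, z, fun r => if r = wit a U then Fin.last _ else (A.coord r).castSucc⟩
    have hB : ∀ {l : ℕ} (b : Fin l → F.HenkinTerm n), (∀ i, b i ≠ wit a U) →
        B.coord ∘ b = Fin.castSucc ∘ A.coord ∘ b := fun b hb =>
      funext fun i => if_neg (hb i)
    have hBA : ∀ {l : ℕ} (b : Fin l → F.HenkinTerm n), (∀ i, b i ≠ wit a U) →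
        B.eval b = A.eval b := by
      intro l b hb
      rw [Assignment.eval, hB b hb, F.map_comp, hzA, Assignment.eval]
    refine ⟨B, (hBA var fun _ => nofun).trans hA, fun r hr => ?_⟩
    rcases Finset.mem_insert.1 hr with rfl | hr
    · rintro k' a' U' h -
      cases h
      have : B.coord ∘ Fin.snoc a (wit a U) =
          Fin.snoc (Fin.castSucc ∘ A.coord ∘ a) (Fin.last A.m) := by
        rw [Fin.comp_snoc, hB a fun i h => (depth_lt a U i).ne (congrArg depth h)]
        exact congrArg _ (if_pos rfl)
      rw [Assignment.eval, this]
      exact hz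
    · rintro k' a' U' rfl h
      have hne : ∀ i, a' i ≠ wit a U := fun i h =>
        (depth_lt a' U' i).not_ge (h ▸ hmax _ hr)
      have hne' : ∀ i, Fin.snoc (α := fun _ => F.HenkinTerm n) a' (wit a' U') i ≠ wit a U := by
        intro i
        cases i using Fin.lastCases with
        | last =>
          rw [Fin.snoc_last]
          rintro h
          exact ht (h ▸ hr)
        | cast i =>
          rw [Fin.snoc_castSucc]
          exact hne i
      rw [hBA _ hne']
      exact hs _ hr _ _ _ rfl (hBA _ hne ▸ h)

/-- Every point of `F_n` with `n > 0` extends to a point family with witnesses. -/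
theorem exists_pointFamily [NeZero n] (p : F.space n) :
    ∃ P : F.PointFamily (F.HenkinTerm n), P.HasWitnesses ∧ P.pt var = p := by
  choose A hAp hA using exists_assignment (F := F) p
  -- Each Henkin condition holds for all sufficiently large finite sets, hence along `𝒰`.
  let 𝒰 : Ultrafilter (Finset (F.HenkinTerm n)) := .of .atTop
  have hlim : ∀ {k : ℕ} (a : Fin k → F.HenkinTerm n), ∃ x : F.space k,
      ∀ U : CompactOpens (F.space k),
        x ∈ U ↔ ∀ᶠ s in (𝒰 : Filter (Finset (F.HenkinTerm n))), (A s).eval a ∈ U :=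
    fun a => (𝒰.map fun s => (A s).eval a).exists_forall_mem_compactOpens_iff
  choose pt hpt using @hlim
  refine ⟨⟨pt, fun f a => SpectralSpace.eq_of_forall_mem_compactOpens_iff fun U => ?_⟩,
    fun {k} a U h => ⟨wit a U, ?_⟩, SpectralSpace.eq_of_forall_mem_compactOpens_iff fun U => ?_⟩
  · refine (hpt a (F.preimage f U)).trans ((hpt _ U).trans ?_).symm
    simp only [← Assignment.map_eval]
    rfl
  · refine (hpt _ U).2 ?_
    have hge : ∀ᶠ s in (𝒰 : Filter (Finset (F.HenkinTerm n))), wit a U ∈ s :=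
      Ultrafilter.of_le _ ((Filter.eventually_ge_atTop {wit a U}).mono fun s hs => by simpa using hs)
    filter_upwards [hge, (hpt a _).1 h] with s hs hsa
    exact hA s _ hs _ _ _ rfl hsa
  · refine (hpt _ U).trans ?_
    simp [hAp]

end HenkinTerm

/-! ### Realization of points and completeness -/

/-- Every point of `F_n` is realized by a tuple in a separated point family with witnesses. -/
theorem exists_pointFamily {n : ℕ} (p : F.space n) :
    ∃ (M : Type u) (Q : F.PointFamily M), Q.HasWitnesses ∧ Q.IsSeparated ∧
      ∃ b : Fin n → M, Q.pt b = p := by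
  rcases Nat.eq_zero_or_pos n with rfl | hn
  -- With no variables, either `p` lifts to `F_1`, or it asserts no existence and the empty
  -- structure realizes it.
  · by_cases hp : p ∈ F.image Fin.castSucc (⊤ : CompactOpens (F.space 1))
    · obtain ⟨q, -, rfl⟩ := hp
      obtain ⟨P, hw, rfl⟩ := HenkinTerm.exists_pointFamily q
      obtain ⟨M, Q, hQw, hQs, b, hb⟩ := P.exists_isSeparated hw HenkinTerm.var
      exact ⟨M, Q, hQw, hQs, b ∘ Fin.castSucc, by rw [← Q.map_pt, hb]⟩
    · refine ⟨PEmpty, ⟨fun {k} a => F.map (fun i => (a i).elim) p, fun f a => ?_⟩, ?_,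
        fun c => c.elim, Fin.elim0, ?_⟩
      · rw [← F.map_comp]
        congr 2
      · intro k a U h
        cases k with
        | succ k => exact (a 0).elim
        | zero =>
          obtain ⟨y, -, hy⟩ := h
          refine (hp ⟨y, trivial, ?_⟩).elim
          rw [hy]
          exact (congrArg (fun f => F.map f p) (Subsingleton.elim _ _)).trans (F.map_id p)
      · exact (congrArg (fun f => F.map f p) (Subsingleton.elim _ _)).trans (F.map_id p)
  · have : NeZero n := ⟨hn.ne'⟩
    obtain ⟨P, hw, rfl⟩ := HenkinTerm.exists_pointFamily p
    exact P.exists_isSeparated hw HenkinTerm.var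

end TypeSpaceFunctor

/-- `Th(F) ⊨ ∀ x̄ (φ(x̄) → ψ(x̄))` if and only if `⟦φ⟧ ⊆ ⟦ψ⟧`. -/
theorem mainTheorem4 (F : TypeSpaceFunctor.{u}) (n : ℕ) (φ ψ : CohFormula F.lang n) :
    F.theory.Entails ⟨n, φ, ψ⟩ ↔
      (F.interp φ : Set (F.space n)) ⊆ (F.interp ψ : Set (F.space n)) := by
  refine ⟨fun h p hp => ?_, fun h M _ hM => hM _ h⟩
  obtain ⟨M, P, hw, hs, b, rfl⟩ := F.exists_pointFamily p
  let := P.toStructure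
  exact (P.realize_iff hw hs ψ b).1 (h M (P.isModel hw hs) b ((P.realize_iff hw hs φ b).2 hp))
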